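/- Let $G=(V,E)$ be a finite graph (loops and parallel edges allowed), and let $M$ be the cographic matroid of $G$, i.e. the matroid on $E$ dual to the graphic matroid of $G$, whose independent sets are the acyclic sets of edges. Then there exists a $6$-competitive non-adaptive mechanism for $M$. Here a non-adaptive mechanism takes as input the distributions of the values $X_e$, $e\in E$, and draws, possibly at random but independently of the realization of $(X_e)_{e\in E}$, thresholds $T_e\in\mathbb{R}\cup\{+\infty\}$, $e\in E$. The items $e\in E$ then arrive one by one, and the gambler accepts an arriving item $e$ if and only if $X_e\ge T_e$ and $e$ together with all previously accepted items is an independent set of $M$. The mechanism is $6$-competitive if for all independent non-negative random variables $X_e$, $e\in E$, $$\mathbb{E}_{T}\Bigl[\min_{\pi}\;\mathbb{E}_{X}\Bigl[\sum_{e\text{ accepted}}X_e\Bigr]\Bigr]\;\ge\;\frac16\;\mathbb{E}_X\Bigl[\max_{S\text{ independent in }M}\;\sum_{e\in S}X_e\Bigr],$$ where $\pi$ ranges over all arrival orders of $E$. Thus the adversary who chooses the order knows the distributions and the mechanism (even the thresholds drawn), but not the realization of the values. -/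

import Mathlib

open MeasureTheory ProbabilityTheory
open scoped NNReal ENNReal

universe u v w

noncomputable section

namespace MatroidProphet

/-! ### Graphic and cographic matroids of a finite multigraph -/

section Graphic

variable {α β : Type*} (G : Graph α β)

/-- `C` is the edge set of a cycle of `G`: there are distinct vertices `v 0, …, v n` and distinct
edges `f 0, …, f n` such that `f i` joins `v i` to `v (i + 1)`, indices being taken modulo `n + 1`.
(For `n = 0` this is a loop, for `n = 1` a pair of parallel edges.) -/
def IsCycle (C : Set β) : Prop :=
  ∃ (n : ℕ) (v : Fin (n + 1) → α) (f : Fin (n + 1) → β),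
    Function.Injective v ∧ Function.Injective f ∧
      (∀ i, G.IsLink (f i) (v i) (v (i + 1))) ∧ Set.range f = C

/-- `F` is a set of edges of `G` that contains no cycle. -/
def IsAcyclic (F : Set β) : Prop :=
  F ⊆ G.edgeSet ∧ ∀ C ⊆ F, ¬ IsCycle G C

/-- The vertices `x` and `y` are joined by a walk that uses edges of `F` only. -/
def Joined (F : Set β) : α → α → Prop :=
  Relation.ReflTransGen fun x y => ∃ e ∈ F, G.IsLink e x y

variable {G}

theorem Joined.symm {F : Set β} {x y : α} (h : Joined G F x y) : Joined G F y x := by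
  induction h with
  | refl => exact Relation.ReflTransGen.refl
  | tail _ hbc ih =>
    obtain ⟨e, he, hl⟩ := hbc
    exact Relation.ReflTransGen.head ⟨e, he, hl.symm⟩ ih

theorem IsCycle.exists_joined {C F : Set β} (hC : IsCycle G C) (hCF : C ⊆ F) :
    ∃ e ∈ F, ∃ x y, G.IsLink e x y ∧ Joined G (F \ {e}) x y := by
  obtain ⟨n, v, f, -, hf, hl, rfl⟩ := hC
  refine ⟨f 0, hCF ⟨0, rfl⟩, v 0, v (0 + 1), hl 0, Joined.symm ?_⟩
  have hs : ∀ k : ℕ, Fin.ofNat (n + 1) (k + 1) = Fin.ofNat (n + 1) k + 1 := fun k =>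
    Fin.ext (by simp [Fin.val_add])
  have key : ∀ k : ℕ, k ≤ n →
      Joined G (F \ {f 0}) (v (0 + 1)) (v (Fin.ofNat (n + 1) (k + 1))) := by
    intro k
    induction k with
    | zero => intro _; rw [hs 0]; exact Relation.ReflTransGen.refl
    | succ k ih =>
      intro hk
      refine (ih (by omega)).tail ⟨f (Fin.ofNat (n + 1) (k + 1)), ⟨hCF ⟨_, rfl⟩, ?_⟩, ?_⟩
      · intro h0
        have h1 := congrArg Fin.val (hf h0)
        simp only [Fin.val_ofNat, Fin.val_zero] at h1
        rw [Nat.mod_eq_of_lt (by omega)] at h1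
        omega
      · rw [hs (k + 1)]
        exact hl _
  have hn := key n le_rfl
  have h0 : Fin.ofNat (n + 1) (n + 1) = 0 := Fin.ext (by simp)
  rwa [h0] at hn

theorem exists_isCycle {F : Set β} {e : β} {x y : α} (he : e ∈ F) (hl : G.IsLink e x y)
    (hj : Joined G (F \ {e}) y x) : ∃ C ⊆ F, IsCycle G C := by
  classical
  let P : ℕ → Prop := fun n => ∃ (p : ℕ → α) (g : ℕ → β), p 0 = y ∧ p n = x ∧
    ∀ i < n, g i ∈ F \ {e} ∧ G.IsLink (g i) (p i) (p (i + 1))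
  have hP : ∃ n, P n := by
    clear hl
    induction hj with
    | refl => exact ⟨0, fun _ => y, fun _ => e, rfl, rfl, by simp⟩
    | @tail b c _ hbc ih =>
      obtain ⟨n, p, g, h0, hn, hg⟩ := ih
      obtain ⟨e', he', hl'⟩ := hbc
      refine ⟨n + 1, fun k => if k ≤ n then p k else c, fun k => if k < n then g k else e',
        by simp [h0], by simp, ?_⟩
      intro i hi
      rcases Nat.lt_succ_iff_lt_or_eq.1 hi with h | rfl
      · simpa [h, h.le, Nat.succ_le_of_lt h] using hg i h
      · simpa [hn] using ⟨he', hl'⟩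
  obtain ⟨p, g, h0, hn, hg⟩ := Nat.find_spec hP
  have hmin : ∀ m < Nat.find hP, ¬ P m := fun m hm => Nat.find_min hP hm
  generalize Nat.find hP = n at hn hg hmin
  have hp : ∀ i j, i < j → j ≤ n → p i ≠ p j := by
    intro i j hij hjn h
    refine hmin (n - (j - i)) (by omega)
      ⟨fun k => if k ≤ i then p k else p (k + (j - i)),
        fun k => if k < i then g k else g (k + (j - i)), by simp [h0], ?_, ?_⟩
    · by_cases hc : n - (j - i) ≤ i
      · have h1 : n - (j - i) = i := by omega
        have h2 : j = n := by omega
        simp only [h1, le_refl, if_true]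
        rw [h, h2, hn]
      · simp only [hc, if_false]
        rw [show n - (j - i) + (j - i) = n by omega, hn]
    · intro k hk
      rcases lt_trichotomy k i with hki | rfl | hki
      · simpa [hki, hki.le, Nat.succ_le_of_lt hki] using hg k (by omega)
      · have h1 := hg j (by omega)
        have h2 : k + (j - k) = j := by omega
        have h3 : k + 1 + (j - k) = j + 1 := by omega
        simpa [h2, h3, h] using h1
      · have h1 := hg (k + (j - i)) (by omega)
        have h3 : k + 1 + (j - i) = k + (j - i) + 1 := by omega
        simpa [hki.not_ge, hki.not_gt, show ¬ k + 1 ≤ i by omega, h3] using h1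
  have hpi : ∀ i j, i ≤ n → j ≤ n → p i = p j → i = j := by
    intro i j hi hj h
    rcases lt_trichotomy i j with h' | h' | h'
    · exact absurd h (hp i j h' hj)
    · exact h'
    · exact absurd h.symm (hp j i h' hi)
  have hgi : ∀ i j, i < j → j < n → g i ≠ g j := by
    intro i j hij hjn h
    have h1 := (hg i (by omega)).2
    rw [h] at h1
    rcases h1.left_eq_or_eq (hg j hjn).2 with h2 | h2
    · have := hpi _ _ (by omega) (by omega) h2
      omega
    · have := hpi _ _ (by omega) (by omega) h2
      omega
  refine ⟨Set.range fun k : Fin (n + 1) => if (k : ℕ) < n then g k else e, ?_, n,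
    fun k => p k, fun k => if (k : ℕ) < n then g k else e, ?_, ?_, ?_, rfl⟩
  · rintro _ ⟨k, rfl⟩
    by_cases hk : (k : ℕ) < n
    · simpa [hk] using (hg k hk).1.1
    · simpa [hk] using he
  · intro i j h
    exact Fin.ext (hpi _ _ (by omega) (by omega) h)
  · intro i j h
    by_cases hi : (i : ℕ) < n <;> by_cases hj : (j : ℕ) < n <;> simp only [hi, hj, if_true,
      if_false] at h
    · rcases lt_trichotomy (i : ℕ) j with h' | h' | h'
      · exact absurd h (hgi _ _ h' hj)
      · exact Fin.ext h'
      · exact absurd h.symm (hgi _ _ h' hi)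
    · exact absurd h (hg i hi).1.2
    · exact absurd h.symm (hg j hj).1.2
    · exact Fin.ext (by omega)
  · intro i
    by_cases hi : (i : ℕ) < n
    · have h1 : ((i + 1 : Fin (n + 1)) : ℕ) = i + 1 := by
        apply Fin.val_add_one_of_lt
        exact hi
      simpa [hi, h1] using (hg i hi).2
    · have h2 : i = Fin.last n := Fin.ext (by simp; omega)
      subst h2
      simpa [hn, h0] using hl

/-- A set of edges is acyclic iff none of its edges closes a walk formed by the others. -/
theorem isAcyclic_iff {F : Set β} : IsAcyclic G F ↔
    F ⊆ G.edgeSet ∧ ∀ e ∈ F, ∀ x y, G.IsLink e x y → ¬ Joined G (F \ {e}) x y := by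
  refine and_congr_right fun _ => ⟨?_, ?_⟩
  · intro h e he x y hl hj
    obtain ⟨C, hC, hC'⟩ := exists_isCycle he hl hj.symm
    exact h C hC hC'
  · intro h C hC hC'
    obtain ⟨e, he, x, y, hl, hj⟩ := hC'.exists_joined hC
    exact h e he x y hl hj

variable (G)

open Classical in
/-- The signed incidence vector of an edge, with an arbitrary orientation. -/
def incVec (e : β) : α →₀ ℚ :=
  if h : ∃ x y, G.IsLink e x y then
    Finsupp.single h.choose 1 - Finsupp.single h.choose_spec.choose 1
  else 0

variable {G}

theorem incVec_eq {e : β} {x y : α} (hl : G.IsLink e x y) :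
    incVec G e = Finsupp.single x 1 - Finsupp.single y 1 ∨
      incVec G e = -(Finsupp.single x 1 - Finsupp.single y 1) := by
  have h : ∃ x y, G.IsLink e x y := ⟨x, y, hl⟩
  rw [incVec, dif_pos h]
  have h3 := h.choose_spec.choose_spec
  generalize h.choose_spec.choose = b at h3 ⊢
  generalize h.choose = a at h3 ⊢
  rcases h3.eq_and_eq_or_eq_and_eq hl with ⟨rfl, rfl⟩ | ⟨rfl, rfl⟩
  · exact Or.inl rfl
  · exact Or.inr (neg_sub _ _).symm

theorem joined_iff_mem_span {F : Set β} {e : β} {x y : α} (hl : G.IsLink e x y) :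
    Joined G F x y ↔ incVec G e ∈ Submodule.span ℚ (incVec G '' F) := by
  have aux : incVec G e ∈ Submodule.span ℚ (incVec G '' F) ↔
      (Finsupp.single x 1 - Finsupp.single y 1 : α →₀ ℚ) ∈
        Submodule.span ℚ (incVec G '' F) := by
    rcases incVec_eq hl with h | h <;> rw [h]
    exact Submodule.neg_mem_iff _
  rw [aux]
  constructor
  · intro h
    clear aux hl
    induction h with
    | refl => simp
    | @tail b c _ hbc ih =>
      obtain ⟨f, hf, hlf⟩ := hbc
      have h1 : (Finsupp.single b 1 - Finsupp.single c 1 : α →₀ ℚ) ∈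
          Submodule.span ℚ (incVec G '' F) := by
        have h2 : incVec G f ∈ Submodule.span ℚ (incVec G '' F) :=
          Submodule.subset_span ⟨f, hf, rfl⟩
        rcases incVec_eq hlf with h | h <;> rw [h] at h2
        · exact h2
        · exact (Submodule.neg_mem_iff _).1 h2
      simpa using Submodule.add_mem _ ih h1
  · intro h
    let s : Setoid α := ⟨Joined G F, fun _ => Relation.ReflTransGen.refl, fun h => h.symm,
      fun h h' => Relation.ReflTransGen.trans h h'⟩
    let L : (α →₀ ℚ) →ₗ[ℚ] (Quotient s →₀ ℚ) := Finsupp.lmapDomain ℚ ℚ (Quotient.mk s)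
    have hL : Submodule.span ℚ (incVec G '' F) ≤ LinearMap.ker L := by
      rw [Submodule.span_le]
      rintro _ ⟨f, hf, rfl⟩
      by_cases hx : ∃ a b, G.IsLink f a b
      · obtain ⟨a, b, hab⟩ := hx
        have hq : Quotient.mk s a = Quotient.mk s b :=
          Quotient.sound (Relation.ReflTransGen.single ⟨f, hf, hab⟩)
        have hz : L (Finsupp.single a 1 - Finsupp.single b 1) = 0 := by
          rw [map_sub, sub_eq_zero]
          simp only [L, Finsupp.lmapDomain_apply, Finsupp.mapDomain_single, hq]
        rcases incVec_eq hab with h | h <;> rw [h]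
        · exact hz
        · exact Submodule.neg_mem _ hz
      · rw [incVec, dif_neg hx]
        exact Submodule.zero_mem _
    have h1 := hL h
    rw [LinearMap.mem_ker, map_sub, sub_eq_zero] at h1
    simp only [L, Finsupp.lmapDomain_apply, Finsupp.mapDomain_single] at h1
    exact Quotient.exact (Finsupp.single_left_injective (one_ne_zero) h1)

theorem isAcyclic_iff_linearIndepOn {F : Set β} :
    IsAcyclic G F ↔ F ⊆ G.edgeSet ∧ LinearIndepOn ℚ (incVec G) F := by
  rw [isAcyclic_iff, linearIndepOn_iff_notMem_span]
  refine and_congr_right fun hF => forall₂_congr fun e he => ?_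
  obtain ⟨x, y, hl⟩ := G.exists_isLink_of_mem_edgeSet (hF he)
  constructor
  · intro h
    rw [← joined_iff_mem_span hl]
    exact h x y hl
  · intro h x' y' hl'
    rwa [joined_iff_mem_span hl']

theorem IsAcyclic.exists_insert {I J : Set β} (hE : G.edgeSet.Finite) (hI : IsAcyclic G I)
    (hJ : IsAcyclic G J) (hIJ : I.ncard < J.ncard) :
    ∃ e ∈ J, e ∉ I ∧ IsAcyclic G (insert e I) := by
  rw [isAcyclic_iff_linearIndepOn] at hI hJ
  have hIf : I.Finite := hE.subset hI.1
  have hJf : J.Finite := hE.subset hJ.1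
  by_contra! hcon
  have hsub : ∀ e ∈ J, incVec G e ∈ Submodule.span ℚ (incVec G '' I) := by
    intro e he
    by_cases heI : e ∈ I
    · exact Submodule.subset_span ⟨e, heI, rfl⟩
    · by_contra hne
      refine hcon e he heI (isAcyclic_iff_linearIndepOn.2
        ⟨Set.insert_subset (hJ.1 he) hI.1, hI.2.insert hne⟩)
  have := hIf.to_subtype
  have := hJf.to_subtype
  have := Fintype.ofFinite I
  have := Fintype.ofFinite J
  have hle : Submodule.span ℚ (incVec G '' J) ≤ Submodule.span ℚ (incVec G '' I) := by
    rw [Submodule.span_le]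
    rintro _ ⟨e, he, rfl⟩
    exact hsub e he
  have hfin : FiniteDimensional ℚ (Submodule.span ℚ (incVec G '' I)) :=
    FiniteDimensional.span_of_finite ℚ (hIf.image _)
  have h1 := Submodule.finrank_mono hle
  have hcI : Module.finrank ℚ (Submodule.span ℚ (incVec G '' I)) = I.ncard := by
    rw [Set.image_eq_range, finrank_span_eq_card hI.2, Set.ncard_eq_toFinset_card',
      Set.toFinset_card]
  have hcJ : Module.finrank ℚ (Submodule.span ℚ (incVec G '' J)) = J.ncard := by
    rw [Set.image_eq_range, finrank_span_eq_card hJ.2, Set.ncard_eq_toFinset_card',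
      Set.toFinset_card]
  omega

variable (G)

/-- The graphic matroid of a multigraph with finitely many edges: its ground set is the edge set,
and its independent sets are the acyclic sets of edges. -/
def graphicMatroid (hE : G.edgeSet.Finite) : Matroid β :=
  (IndepMatroid.ofFinite hE (IsAcyclic G)
    (isAcyclic_iff_linearIndepOn.2 ⟨Set.empty_subset _, linearIndepOn_empty ℚ _⟩)
    (fun _ _ hJ hIJ => ⟨hIJ.trans hJ.1, fun C hC => hJ.2 C (hC.trans hIJ)⟩)
    (fun _ _ hI hJ hIJ => hI.exists_insert hE hJ hIJ)
    (fun _ hI => hI.1)).matroid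

/-- The cographic matroid of a multigraph: the dual of its graphic matroid. -/
def cographicMatroid (hE : G.edgeSet.Finite) : Matroid β :=
  (graphicMatroid G hE)✶

theorem cographicMatroid_indep_iff (hE : G.edgeSet.Finite) {A : Set β} :
    (cographicMatroid G hE).Indep A ↔
      A ⊆ G.edgeSet ∧ ∃ B, Maximal (IsAcyclic G) B ∧ Disjoint A B := by
  rw [cographicMatroid, Matroid.dual_indep_iff_exists']
  simp only [Matroid.isBase_iff_maximal_indep]
  rfl

end Graphic

/-! ### The matroid prophet inequality

The items are the elements of the ground set of a matroid `M`, which is finite in all uses. -/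

section Prophet

variable {β : Type*} (M : Matroid β)

/-- A set of items, i.e. of elements of the ground set of `M`, is feasible if it is independent. -/
def Feasible (S : Finset M.E) : Prop :=
  M.Indep (Subtype.val '' (S : Set M.E))

/-- The value obtained by the prophet for the realization `x` of the item values: the maximum
weight of an independent set. -/
def prophetValue (x : M.E → ℝ≥0) : ℝ≥0∞ :=
  ⨆ (S : Finset M.E) (_ : Feasible M S), ∑ e ∈ S, (x e : ℝ≥0∞)

open Classical in
/-- The set of items held by the gambler after the items of a list have arrived one by one, if `S`
is held at the beginning. The gambler accepts an arriving item iff its value is at least its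
threshold and it forms an independent set together with all previously accepted items. -/
def accepted (T : M.E → WithTop ℝ) (x : M.E → ℝ≥0) : Finset M.E → List M.E → Finset M.E
  | S, [] => S
  | S, e :: l =>
    if T e ≤ ((x e : ℝ) : WithTop ℝ) ∧ Feasible M (insert e S) then
      accepted T x (insert e S) l
    else
      accepted T x S l

/-- The value obtained by the gambler with thresholds `T` for the realization `x` of the item
values, if the items arrive in the order `l`. -/
def gamblerValue (T : M.E → WithTop ℝ) (x : M.E → ℝ≥0) (l : List M.E) : ℝ≥0∞ :=
  ∑ e ∈ accepted M T x ∅ l, (x e : ℝ≥0∞)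

/-- An arrival order: a list in which every item occurs exactly once. -/
def ArrivalOrder (ι : Type*) : Type _ :=
  {l : List ι // l.Nodup ∧ ∀ e, e ∈ l}

/-- A (randomized) non-adaptive mechanism for the items `ι`. Given the distributions of the item
values, it draws a vector of thresholds, each of which is a real number or `+∞`. The thresholds are
drawn from the probability measure `law D` on vectors of thresholds, where `D e` is the
distribution of the value of item `e`. -/
structure NonAdaptiveMechanism (ι : Type*) where
  law : (ι → Measure ℝ≥0) → Measure (ι → WithTop ℝ)
  isProbabilityMeasure_law : ∀ D : ι → Measure ℝ≥0, (∀ e, IsProbabilityMeasure (D e)) →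
    IsProbabilityMeasure (law D)

/-- The expected value obtained by the gambler with thresholds `T` if the items arrive in the worst
order. The order does not depend on the realization of the item values. -/
def worstCaseGain {Ω : Type*} [MeasurableSpace Ω] (P : Measure Ω) (X : M.E → Ω → ℝ≥0)
    (T : M.E → WithTop ℝ) : ℝ≥0∞ :=
  ⨅ l : ArrivalOrder M.E, ∫⁻ ω, gamblerValue M T (fun e => X e ω) l.1 ∂P

/-- The mechanism `A` is `c`-competitive on the matroid `M`: whenever the item values are
independent non-negative random variables, the expected value obtained by the gambler, over the
item values and the thresholds and against an adversarial arrival order, is at least `1 / c` times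
the expected value obtained by the prophet. -/
def NonAdaptiveMechanism.IsCompetitive {β : Type v} {M : Matroid β}
    (A : NonAdaptiveMechanism M.E) (c : ℝ≥0) : Prop :=
  ∀ (Ω : Type w) [MeasurableSpace Ω] (P : Measure Ω) [IsProbabilityMeasure P]
    (X : M.E → Ω → ℝ≥0), (∀ e, Measurable (X e)) → iIndepFun X P →
    (∫⁻ ω, prophetValue M (fun e => X e ω) ∂P) / c ≤
      ∫⁻ T, worstCaseGain M P X T ∂(A.law fun e => P.map (X e))

end Prophet

end MatroidProphet

end

noncomputable section

namespace MatroidProphet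

/-! The cographic matroid is, up to loops and parallel elements, a union of three independent sets.
Choose one representative from each parallel class of non-loops, and let `A` be any set of
representatives. Contract all edges outside `A`. The edges of `A` at a vertex of the contracted
graph that are not loops there contain a cut of `G` if there are any. Loops of the dual are bridges
and parallel pairs are cuts of size two, so there are at least three of them. Hence the contracted
graph has at most `2|A|/3` non-isolated vertices, a forest in it has at most that many edges, and
the rest of `A`, at least a third of it, is independent in the dual. As this holds for every `A`,
Edmonds' covering theorem gives three independent sets covering the representatives
(`card_le_three_mul_eRk_cographicMatroid`, `exists_indep_cover`).

Pulling these sets back along "take the representative" gives three sets `U i` covering all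
non-loops, in each of which a set with at most one element per parallel class is independent. The
mechanism picks `i` uniformly, blocks all items outside `U i` with threshold `+∞`, and gives each
parallel class within `U i` a single-item threshold that guarantees half of the expected maximum in
any order (`exists_threshold`). An independent set meets each class at most once, so the prophet
gets at most the sum over `i` of the class maxima in `U i`. The factors are 3 for the choice of `i`
and 2 for the single-item inequality. -/

/-- Double counting for sparse vectors: if each of the vectors `w e`, `e ∈ A`, has at most two
nonzero coordinates and each coordinate is zero on all of them or nonzero on at least three, then
at most two thirds of the vectors are linearly independent. -/
theorem three_mul_card_le_of_linearIndepOn {β Q : Type*} (w : β → Q →₀ ℚ) {S A : Finset β}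
    (hSA : S ⊆ A) (hS : LinearIndepOn ℚ w (S : Set β)) (h2 : ∀ e ∈ A, (w e).support.card ≤ 2)
    (h3 : ∀ q, (∃ e ∈ A, w e q ≠ 0) → 3 ≤ (A.filter fun e => w e q ≠ 0).card) :
    3 * S.card ≤ 2 * A.card := by
  -- The independent vectors lie in the span of the coordinates in use, so it suffices to bound the
  -- number of these by counting incidences between vectors and coordinates.
  classical
  let Q' : Finset Q := A.biUnion fun e => (w e).support
  have hSQ : S.card ≤ Q'.card := by
    let b : Finset (Q →₀ ℚ) := Q'.image fun q => Finsupp.single q 1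
    have h := linearIndependent_le_span_aux' (fun e : (S : Set β) => w e) hS (b : Set (Q →₀ ℚ)) ?_
    · have h' : S.card ≤ b.card := by simpa using h
      exact h'.trans Finset.card_image_le
    · rintro _ ⟨⟨e, he⟩, rfl⟩
      change w e ∈ Submodule.span ℚ (b : Set (Q →₀ ℚ))
      rw [← Finsupp.sum_single (w e)]
      refine Submodule.sum_mem _ fun q hq => ?_
      have : Finsupp.single q (w e q) = w e q • Finsupp.single q (1 : ℚ) := by simp
      rw [this]
      exact Submodule.smul_mem _ _ (Submodule.subset_span (Finset.mem_coe.2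
        (Finset.mem_image_of_mem _ (Finset.mem_biUnion.2 ⟨e, hSA he, hq⟩))))
  have hcount : Q'.card • 3 ≤ ∑ q ∈ Q', (A.filter fun e => w e q ≠ 0).card := by
    refine Finset.card_nsmul_le_sum _ _ _ fun q hq => h3 q ?_
    obtain ⟨e, he, hq⟩ := Finset.mem_biUnion.1 hq
    exact ⟨e, he, Finsupp.mem_support_iff.1 hq⟩
  have hswap : ∑ q ∈ Q', (A.filter fun e => w e q ≠ 0).card
      = ∑ e ∈ A, (Q'.filter fun q => w e q ≠ 0).card :=
    Finset.sum_card_bipartiteAbove_eq_sum_card_bipartiteBelow fun q e => w e q ≠ 0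
  have hle : ∑ e ∈ A, (Q'.filter fun q => w e q ≠ 0).card ≤ A.card • 2 := by
    refine Finset.sum_le_card_nsmul _ _ _ fun e he => le_trans (Finset.card_le_card ?_) (h2 e he)
    intro q hq
    exact Finsupp.mem_support_iff.2 (Finset.mem_filter.1 hq).2
  simp only [smul_eq_mul] at hcount hle
  omega

/-! ### Contractions and the rank bound in the cographic matroid -/

section Graphic

variable {α β : Type*} {G : Graph α β}

theorem single_sub_single_mem_span {F : Set β} {x y : α} (h : Joined G F x y) :
    (Finsupp.single x 1 - Finsupp.single y 1 : α →₀ ℚ) ∈ Submodule.span ℚ (incVec G '' F) := by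
  induction h with
  | refl => simp
  | @tail b c _ hbc ih =>
    obtain ⟨f, hf, hlf⟩ := hbc
    have h1 : (Finsupp.single b 1 - Finsupp.single c 1 : α →₀ ℚ) ∈
        Submodule.span ℚ (incVec G '' F) := by
      have h2 : incVec G f ∈ Submodule.span ℚ (incVec G '' F) :=
        Submodule.subset_span ⟨f, hf, rfl⟩
      rcases incVec_eq hlf with h | h <;> rw [h] at h2
      · exact h2
      · exact (Submodule.neg_mem_iff _).1 h2
    simpa using Submodule.add_mem _ ih h1

/-- The vertices of the graph obtained by contracting the edges of `F`. -/
def contractSetoid (G : Graph α β) (F : Set β) : Setoid α :=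
  ⟨Joined G F, fun _ => Relation.ReflTransGen.refl, fun h => h.symm,
    fun h h' => Relation.ReflTransGen.trans h h'⟩

/-- The linear map on vertex chains induced by contracting the edges of `F`. -/
def contractMap (G : Graph α β) (F : Set β) :
    (α →₀ ℚ) →ₗ[ℚ] (Quotient (contractSetoid G F) →₀ ℚ) :=
  Finsupp.lmapDomain ℚ ℚ (Quotient.mk _)

/-- Moving every vertex to the chosen representative of its class changes a chain by a combination
of differences of `F`-joined vertices. A chain in the kernel is therefore itself such a combination.
-/
theorem ker_contractMap_le (F : Set β) :
    LinearMap.ker (contractMap G F) ≤ Submodule.span ℚ (incVec G '' F) := by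
  intro v hv
  let ψ : (Quotient (contractSetoid G F) →₀ ℚ) →ₗ[ℚ] (α →₀ ℚ) := Finsupp.lmapDomain ℚ ℚ Quotient.out
  have key : ∀ v : α →₀ ℚ, v - ψ (contractMap G F v) ∈ Submodule.span ℚ (incVec G '' F) := by
    intro v
    induction v using Finsupp.induction_linear with
    | zero => simp
    | add f g hf hg =>
      rw [map_add, map_add, add_sub_add_comm]
      exact Submodule.add_mem _ hf hg
    | single a b =>
      have h1 : Joined G F a (Quotient.mk (contractSetoid G F) a).out :=
        Joined.symm (Quotient.mk_out (s := contractSetoid G F) a)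
      have h2 := Submodule.smul_mem _ b (single_sub_single_mem_span h1)
      simpa [ψ, contractMap, Finsupp.mapDomain_single, smul_sub] using h2
  have := key v
  rwa [LinearMap.mem_ker.1 hv, map_zero, sub_zero] at this

theorem contractMap_incVec {F : Set β} {e : β} {x y : α} (hl : G.IsLink e x y) :
    contractMap G F (incVec G e) = Finsupp.single (Quotient.mk _ x) 1 -
        Finsupp.single (Quotient.mk _ y) 1 ∨
      contractMap G F (incVec G e) = -(Finsupp.single (Quotient.mk _ x) 1 -
        Finsupp.single (Quotient.mk _ y) 1) := by
  have hs : contractMap G F (Finsupp.single x 1 - Finsupp.single y 1) =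
      Finsupp.single (Quotient.mk _ x) 1 - Finsupp.single (Quotient.mk _ y) 1 := by
    rw [map_sub]
    simp only [contractMap, Finsupp.lmapDomain_apply, Finsupp.mapDomain_single]
  rcases incVec_eq hl with h | h <;> rw [h]
  · exact Or.inl hs
  · exact Or.inr (by rw [map_neg, hs])

theorem contractMap_incVec_of_mem {F : Set β} {e : β} (heF : e ∈ F) (he : e ∈ G.edgeSet) :
    contractMap G F (incVec G e) = 0 := by
  obtain ⟨x, y, hl⟩ := G.exists_isLink_of_mem_edgeSet he
  have hq : Quotient.mk (contractSetoid G F) x = Quotient.mk _ y :=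
    Quotient.sound (Relation.ReflTransGen.single ⟨e, heF, hl⟩)
  rcases contractMap_incVec (F := F) hl with h | h <;> rw [h, hq] <;> simp

theorem card_support_contractMap_incVec_le {F : Set β} {e : β} (he : e ∈ G.edgeSet) :
    (contractMap G F (incVec G e)).support.card ≤ 2 := by
  classical
  obtain ⟨x, y, hl⟩ := G.exists_isLink_of_mem_edgeSet he
  have hs : (contractMap G F (incVec G e)).support ⊆ {Quotient.mk _ x, Quotient.mk _ y} := by
    intro q hq
    rw [Finsupp.mem_support_iff] at hq
    simp only [Finset.mem_insert, Finset.mem_singleton]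
    by_contra! hne
    apply hq
    rcases contractMap_incVec (F := F) hl with h | h <;> rw [h] <;>
      simp [hne.1.symm, hne.2.symm]
  exact (Finset.card_le_card hs).trans Finset.card_le_two

theorem graphicMatroid_indep_iff (hE : G.edgeSet.Finite) {I : Set β} :
    (graphicMatroid G hE).Indep I ↔ I ⊆ G.edgeSet ∧ LinearIndepOn ℚ (incVec G) I :=
  isAcyclic_iff_linearIndepOn

theorem incVec_mem_span_of_isBasis (hE : G.edgeSet.Finite) {I F : Set β}
    (hI : (graphicMatroid G hE).IsBasis I F) {e : β} (he : e ∈ F) :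
    incVec G e ∈ Submodule.span ℚ (incVec G '' I) := by
  by_contra hne
  have hi := (graphicMatroid_indep_iff hE).1 hI.indep
  have h1 : (graphicMatroid G hE).Indep (insert e I) :=
    (graphicMatroid_indep_iff hE).2
      ⟨Set.insert_subset (hI.subset_ground he) hi.1, hi.2.insert hne⟩
  exact hne (Submodule.subset_span ⟨e, hI.mem_of_insert_indep he h1, rfl⟩)

/-- The edges on which a linear functional does not vanish contain a cut of the graph. -/
theorem not_cographicMatroid_indep_of_functional (hE : G.edgeSet.Finite) {D : Set β}
    (φ : (α →₀ ℚ) →ₗ[ℚ] ℚ) {e : β} (he : e ∈ G.edgeSet) (hφ : φ (incVec G e) ≠ 0)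
    (hD : ∀ f ∈ G.edgeSet, φ (incVec G f) ≠ 0 → f ∈ D) : ¬ (cographicMatroid G hE).Indep D := by
  intro h
  rw [cographicMatroid, Matroid.dual_indep_iff_exists'] at h
  obtain ⟨-, B, hB, hDB⟩ := h
  -- A functional vanishing on a base of the graphic matroid vanishes on every edge, whereas `φ`
  -- does not vanish on `e`.
  have hle : Submodule.span ℚ (incVec G '' B) ≤ LinearMap.ker φ := by
    rw [Submodule.span_le]
    rintro _ ⟨f, hf, rfl⟩
    by_contra hne
    exact Set.disjoint_left.1 hDB (hD f (hB.subset_ground hf) hne) hf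
  exact hφ (hle (incVec_mem_span_of_isBasis hE hB.isBasis_ground he))

/-- A set of edges containing no bridge and no cut of size two is at most three times as large as
its rank in the cographic matroid. -/
theorem card_le_three_mul_eRk_cographicMatroid (hE : G.edgeSet.Finite) (A : Finset β)
    (hA : (A : Set β) ⊆ G.edgeSet)
    (hind : ∀ D ⊆ A, D.card ≤ 2 → (cographicMatroid G hE).Indep (D : Set β)) :
    (A.card : ℕ∞) ≤ 3 * (cographicMatroid G hE).eRk (A : Set β) := by
  classical
  let M := graphicMatroid G hE
  let F : Set β := G.edgeSet \ A
  obtain ⟨I, hI⟩ := M.exists_isBasis F Set.sdiff_subset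
  obtain ⟨B, hB, hIB⟩ := hI.indep.exists_isBase_superset
  -- `S` remains a forest after contracting `F`, because `B` extends a basis of `F`; and `A \ S`
  -- avoids the base `B`, so it is independent in the dual.
  let S : Finset β := A.filter (· ∈ B)
  have hSB : (S : Set β) ⊆ B := fun e he => (Finset.mem_filter.1 he).2
  have hSA : S ⊆ A := Finset.filter_subset _ _
  have hSI : Disjoint (S : Set β) I := by
    rw [Set.disjoint_left]
    intro e he heI
    exact (hI.subset heI).2 (hSA he)
  have hBl : LinearIndepOn ℚ (incVec G) B := ((graphicMatroid_indep_iff hE).1 hB.indep).2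
  have hker : LinearMap.ker (contractMap G F) ≤ Submodule.span ℚ (incVec G '' I) := by
    refine (ker_contractMap_le F).trans (Submodule.span_le.2 ?_)
    rintro _ ⟨e, he, rfl⟩
    exact incVec_mem_span_of_isBasis hE hI he
  have hSl : LinearIndepOn ℚ (fun e => contractMap G F (incVec G e)) (S : Set β) := by
    have h1 : LinearIndepOn ℚ (incVec G) ((S : Set β) ∪ I) := hBl.mono (Set.union_subset hSB hIB)
    obtain ⟨h2, -, h3⟩ := (linearIndepOn_union_iff hSI).1 h1
    refine LinearIndependent.map (f := contractMap G F) h2 ?_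
    rw [Set.image_eq_range] at h3
    -- The span of `S` meets the span of `I` trivially, and the kernel of the contraction lies in
    -- the latter.
    exact h3.mono_right hker
  have hcard : 3 * S.card ≤ 2 * A.card := by
    refine three_mul_card_le_of_linearIndepOn _ hSA hSl
      (fun e he => card_support_contractMap_incVec_le (hA he)) fun q ⟨e, he, hq⟩ => ?_
    -- Edges of `F` contract to zero, so every edge with nonzero coordinate at `q` lies in `A`.
    -- These edges contain a cut, yet two or fewer edges of `A` are independent in the dual.
    by_contra! hlt
    refine not_cographicMatroid_indep_of_functional hE
      ((Finsupp.lapply q).comp (contractMap G F)) (hA he) hq ?_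
      (hind _ (Finset.filter_subset (fun e => contractMap G F (incVec G e) q ≠ 0) A) (by omega))
    intro f hf hfq
    have hfA : f ∈ A := by
      by_contra hfA
      apply hfq
      change contractMap G F (incVec G f) q = 0
      rw [contractMap_incVec_of_mem (show f ∈ F from ⟨hf, hfA⟩) hf]
      rfl
    exact Finset.mem_coe.2 (Finset.mem_filter.2 ⟨hfA, hfq⟩)
  have hdual : (cographicMatroid G hE).Indep ((A \ S : Finset β) : Set β) := by
    rw [cographicMatroid, Matroid.dual_indep_iff_exists']
    refine ⟨fun e he => hA (Finset.mem_sdiff.1 he).1, B, hB, ?_⟩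
    rw [Set.disjoint_left]
    intro e he heB
    have := Finset.mem_sdiff.1 he
    exact this.2 (Finset.mem_filter.2 ⟨this.1, heB⟩)
  have h1 := hdual.encard_le_eRk_of_subset (X := (A : Set β))
    (Finset.coe_subset.2 Finset.sdiff_subset)
  rw [Set.encard_coe_eq_coe_finsetCard] at h1
  have h2 : A.card ≤ 3 * (A \ S).card := by
    have := Finset.card_sdiff_add_card_eq_card hSA
    omega
  calc (A.card : ℕ∞) ≤ 3 * ((A \ S).card : ℕ∞) := by exact_mod_cast h2
    _ ≤ _ := by gcongr

end Graphic

/-! ### Matroid covering -/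

/-- A version of Rado's theorem: if `f` is monotone and submodular and `|J| ≤ k f(J)` for all `J`,
then the elements can be coloured with `k` colours so that every set `J` of elements of the same
colour satisfies `|J| ≤ f(J)`. -/
theorem exists_coloring_card_le {β : Type*} [DecidableEq β] {k : ℕ} (f : Finset β → ℕ)
    (hmono : Monotone f) (hsub : ∀ S T, f (S ∩ T) + f (S ∪ T) ≤ f S + f T) (hf0 : f ∅ = 0)
    (R : Finset β) (hR : ∀ J ⊆ R, J.card ≤ k * f J) :
    ∃ c : β → Finset (Fin k), (∀ e ∈ R, ∃ i, c e = {i}) ∧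
      ∀ i, ∀ J ⊆ R, (∀ e ∈ J, c e = {i}) → J.card ≤ f J := by
  -- `P` is Rado's condition for colour lists `L`. Full lists satisfy it by `hR`; lists of minimal
  -- total size subject to it turn out to be singletons.
  let P : (β → Finset (Fin k)) → Prop := fun L =>
    ∀ J ⊆ R, J.card ≤ ∑ i, f (J.filter fun e => i ∈ L e)
  have hex : ∃ n, ∃ L, P L ∧ ∑ e ∈ R, (L e).card = n := by
    refine ⟨_, fun _ => Finset.univ, fun J hJ => ?_, rfl⟩
    simpa using hR J hJ
  classical
  obtain ⟨L, hL, hn⟩ := Nat.find_spec hex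
  have hmin : ∀ L', P L' → ∑ e ∈ R, (L e).card ≤ ∑ e ∈ R, (L' e).card := fun L' hL' => by
    rw [hn]
    exact Nat.find_min' hex ⟨L', hL', rfl⟩
  have herase : ∀ e ∈ R, ∀ i ∈ L e, ∃ J ⊆ R, e ∈ J ∧
      ∑ j, f (J.filter fun x => j ∈ Function.update L e ((L e).erase i) x) < J.card := by
    intro e he i hi
    have hlt : ∑ x ∈ R, (Function.update L e ((L e).erase i) x).card < ∑ x ∈ R, (L x).card := by
      refine Finset.sum_lt_sum (fun x _ => Finset.card_le_card ?_) ⟨e, he, ?_⟩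
      · by_cases hx : x = e
        · subst hx
          simpa using Finset.erase_subset _ _
        · rw [Function.update_of_ne hx]
      · simpa using Finset.card_erase_lt_of_mem hi
    have hnP : ¬ P (Function.update L e ((L e).erase i)) := fun h => (hmin _ h).not_gt hlt
    simp only [P, not_forall, not_le] at hnP
    obtain ⟨J, hJ, hJlt⟩ := hnP
    refine ⟨J, hJ, ?_, hJlt⟩
    by_contra heJ
    refine (hL J hJ).not_gt (lt_of_eq_of_lt (Finset.sum_congr rfl fun j _ => ?_) hJlt)
    congr 1
    refine Finset.filter_congr fun x hx => ?_
    rw [Function.update_of_ne (by rintro rfl; exact heJ hx)]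
  have hone : ∀ e ∈ R, ∃ i, L e = {i} := by
    intro e he
    rw [← Finset.card_eq_one]
    refine le_antisymm ?_ ?_
    · rw [Finset.card_le_one]
      by_contra! hcon
      obtain ⟨i, hi, j, hj, hij⟩ := hcon
      obtain ⟨J₁, hJ₁, he₁, h₁⟩ := herase e he i hi
      obtain ⟨J₂, hJ₂, he₂, h₂⟩ := herase e he j hj
      have h3 := hL (J₁ ∪ J₂) (Finset.union_subset hJ₁ hJ₂)
      have h4 := hL ((J₁ ∩ J₂).erase e)
        ((Finset.erase_subset _ _).trans (Finset.inter_subset_left.trans hJ₁))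
      -- Submodularity, colour by colour. In the union `e` loses no colour, since `J₁` drops only
      -- `i` and `J₂` only `j ≠ i`; from the intersection `e` is removed. The right side is at most
      -- `|J₁| + |J₂| - 2`, while `h3` and `h4` bound the left side below by `|J₁| + |J₂| - 1`.
      have h5 : ∑ l, f (((J₁ ∩ J₂).erase e).filter fun x => l ∈ L x)
          + ∑ l, f ((J₁ ∪ J₂).filter fun x => l ∈ L x) ≤
          ∑ l, f (J₁.filter fun x => l ∈ Function.update L e ((L e).erase i) x) +
          ∑ l, f (J₂.filter fun x => l ∈ Function.update L e ((L e).erase j) x) := by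
        rw [← Finset.sum_add_distrib, ← Finset.sum_add_distrib]
        refine Finset.sum_le_sum fun l _ => le_trans (add_le_add (hmono ?_) (hmono ?_)) (hsub _ _)
        · intro x hx
          simp only [Finset.mem_filter, Finset.mem_erase, Finset.mem_inter] at hx ⊢
          obtain ⟨⟨hxe, hx1, hx2⟩, hl⟩ := hx
          simp [Function.update_of_ne hxe, hx1, hx2, hl]
        · intro x hx
          simp only [Finset.mem_filter, Finset.mem_union] at hx ⊢
          obtain ⟨hx, hl⟩ := hx
          by_cases hxe : x = e
          · subst hxe
            simp only [Function.update_self, Finset.mem_erase, he₁, he₂, hl, true_and, and_true]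
            by_contra! h
            exact hij (h.1.symm.trans h.2)
          · simpa [Function.update_of_ne hxe, hl] using hx
      have h6 := Finset.card_union_add_card_inter J₁ J₂
      have h7 := Finset.card_erase_of_mem (Finset.mem_inter.2 ⟨he₁, he₂⟩)
      have h8 : 0 < (J₁ ∩ J₂).card := Finset.card_pos.2 ⟨e, Finset.mem_inter.2 ⟨he₁, he₂⟩⟩
      omega
    · rw [Nat.one_le_iff_ne_zero, Finset.card_ne_zero]
      by_contra hem
      rw [Finset.not_nonempty_iff_eq_empty] at hem
      have := hL {e} (Finset.singleton_subset_iff.2 he)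
      simp [Finset.filter_singleton, hem, hf0] at this
  refine ⟨L, hone, fun i J hJ hJi => (hL J hJ).trans ?_⟩
  rw [Finset.sum_eq_single i]
  · exact hmono (Finset.filter_subset _ _)
  · intro j _ hji
    rw [Finset.filter_false_of_mem, hf0]
    intro e he
    rw [hJi e he, Finset.mem_singleton]
    exact hji
  · simp

/-- The covering theorem of Edmonds: a finite set `R` with `|J| ≤ k r(J)` for all `J ⊆ R` is the
union of `k` independent sets. -/
theorem exists_indep_cover {β : Type*} (M : Matroid β) {k : ℕ} (R : Finset β)
    (hR : ∀ J ⊆ R, (J.card : ℕ∞) ≤ k * M.eRk (J : Set β)) :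
    ∃ K : Fin k → Set β, (∀ i, M.Indep (K i)) ∧ (∀ i, K i ⊆ R) ∧ ∀ e ∈ R, ∃ i, e ∈ K i := by
  classical
  let f : Finset β → ℕ := fun J => (M.eRk (J : Set β)).toNat
  have hf : ∀ J : Finset β, (f J : ℕ∞) = M.eRk (J : Set β) := fun J =>
    ENat.natCast_toNat (Matroid.eRk_ne_top_iff.2 (M.isRkFinite_of_finite J.finite_toSet))
  obtain ⟨c, hc, hJ⟩ := exists_coloring_card_le (k := k) f
    (fun S T h => by
      have := M.eRk_mono (Finset.coe_subset.2 h)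
      rw [← hf, ← hf] at this
      exact_mod_cast this)
    (fun S T => by
      have := M.eRk_inter_add_eRk_union_le (S : Set β) T
      rw [← Finset.coe_inter, ← Finset.coe_union, ← hf, ← hf, ← hf, ← hf] at this
      exact_mod_cast this)
    (by simp [f]) R
    (fun J h => by
      have := hR J h
      rw [← hf] at this
      exact_mod_cast this)
  refine ⟨fun i => R.filter fun e => c e = {i}, fun i => ?_,
    fun i => Finset.coe_subset.2 (Finset.filter_subset _ _), fun e he => ?_⟩
  · refine (M.isRkFinite_of_finite (Finset.finite_toSet _)).indep_of_encard_le_eRk ?_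
    rw [← hf, Set.encard_coe_eq_coe_finsetCard]
    exact_mod_cast hJ i _ (Finset.filter_subset _ _) fun e he => (Finset.mem_filter.1 he).2
  · obtain ⟨i, hi⟩ := hc e he
    exact ⟨i, by simp [he, hi]⟩

/-! ### Parallel classes -/

theorem injOn_closure_singleton {β : Type*} {M : Matroid β} {S : Set β} (hS : M.Indep S) :
    Set.InjOn (fun e => M.closure {e}) S := by
  intro e he f hf hef
  by_contra hne
  refine hS.notMem_closure_sdiff_of_mem he (M.closure_subset_closure ?_ (?_ : e ∈ M.closure {f}))
  · exact Set.singleton_subset_iff.2 ⟨hf, fun h => hne h.symm⟩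
  · simp only at hef
    rw [← hef]
    exact M.mem_closure_self e (hS.subset_ground he)

/-- Replacing the elements of an independent set by parallel elements gives an independent set. -/
theorem indep_of_parallel {β : Type*} {M : Matroid β} {K S : Set β} (hK : M.Indep K)
    (hS : S ⊆ M.E) (hinj : Set.InjOn (fun e => M.closure {e}) S) (ρ : β → β)
    (hρ : ∀ e ∈ S, ρ e ∈ K ∧ M.closure {ρ e} = M.closure {e}) : M.Indep S := by
  rw [Matroid.indep_iff_forall_notMem_closure_sdiff hS]
  intro e he hcl
  -- Passing to representatives preserves closures, so a dependency of `e` on the rest of `S`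
  -- becomes one of `ρ e` on other elements of `K`; these differ from `ρ e` by `hinj`.
  have h1 : M.closure (S \ {e}) = M.closure (⋃ x ∈ S \ {e}, {ρ x}) := by
    rw [M.closure_biUnion_congr (fun x => {ρ x}) (fun x => {x}) _ fun x hx => (hρ x hx.1).2, Set.biUnion_of_singleton]
  have h2 : ρ e ∈ M.closure (S \ {e}) := by
    have h3 := M.mem_closure_self (ρ e) (hK.subset_ground (hρ e he).1)
    rw [(hρ e he).2] at h3
    exact M.closure_subset_closure_of_subset_closure (Set.singleton_subset_iff.2 hcl) h3
  rw [h1] at h2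
  refine hK.notMem_closure_sdiff_of_mem (hρ e he).1 (M.closure_subset_closure ?_ h2)
  intro y hy
  obtain ⟨x, hx, rfl⟩ := Set.mem_iUnion₂.1 hy
  refine ⟨(hρ x hx.1).1, fun h => hx.2 (hinj hx.1 he ?_)⟩
  simp only [Set.mem_singleton_iff] at h
  simp only
  rw [← (hρ x hx.1).2, h, (hρ e he).2]

/-- In the cographic matroid, the elements that are not loops can be covered by three sets in which
every set without parallel elements is independent. -/
theorem exists_parallel_cover_cographicMatroid {α β : Type*} (G : Graph α β)
    (hE : G.edgeSet.Finite) :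
    ∃ U : Fin 3 → Set β, (∀ e, (cographicMatroid G hE).IsNonloop e → ∃ i, e ∈ U i) ∧
      ∀ i, ∀ S ⊆ U i, Set.InjOn (fun e => (cographicMatroid G hE).closure {e}) S →
        (cographicMatroid G hE).Indep S := by
  classical
  set M := cographicMatroid G hE
  have hne : ∀ e, M.IsNonloop e → ∃ x, M.IsNonloop x ∧ M.closure {x} = M.closure {e} :=
    fun e he => ⟨e, he, rfl⟩
  -- The choice depends on `e` only through its closure, so parallel elements get the same
  -- representative.
  let ρ : β → β := fun e =>
    if h : ∃ x, M.IsNonloop x ∧ M.closure {x} = M.closure {e} then h.choose else e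
  have hρ : ∀ e, M.IsNonloop e → M.IsNonloop (ρ e) ∧ M.closure {ρ e} = M.closure {e} := by
    intro e he
    simp only [ρ, dif_pos (hne e he)]
    exact (hne e he).choose_spec
  have hρ' : ∀ e f, M.closure {e} = M.closure {f} → M.IsNonloop e → M.IsNonloop f → ρ e = ρ f := by
    intro e f hef he hf
    simp only [ρ, dif_pos (hne e he), dif_pos (hne f hf)]
    congr 1
    simp only [hef]
  let R : Finset β := (hE.toFinset.filter M.IsNonloop).image ρ
  have hRn : ∀ x ∈ R, ∃ e, M.IsNonloop e ∧ ρ e = x := by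
    intro x hx
    obtain ⟨e, he, rfl⟩ := Finset.mem_image.1 hx
    exact ⟨e, (Finset.mem_filter.1 he).2, rfl⟩
  have hRnl : ∀ x ∈ R, M.IsNonloop x := by
    intro x hx
    obtain ⟨e, he, rfl⟩ := hRn x hx
    exact (hρ e he).1
  have hRinj : ∀ x ∈ R, ∀ y ∈ R, M.closure {x} = M.closure {y} → x = y := by
    intro x hx y hy hxy
    obtain ⟨e, he, rfl⟩ := hRn x hx
    obtain ⟨f, hf, rfl⟩ := hRn y hy
    rw [(hρ e he).2, (hρ f hf).2] at hxy
    exact hρ' e f hxy he hf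
  obtain ⟨K, hK, hKR, hcov⟩ := exists_indep_cover M (k := 3) R fun J hJ => by
    refine card_le_three_mul_eRk_cographicMatroid hE J
      (fun e he => (hRnl e (hJ he)).mem_ground) fun D hD hD2 => ?_
    by_contra hdep
    have hDn : ∀ x ∈ D, M.IsNonloop x := fun x hx => hRnl x (hJ (hD hx))
    -- The case of size two is the essential one: a dependent pair of non-loops is parallel, and
    -- distinct representatives are not.
    interval_cases hc : D.card
    · rw [Finset.card_eq_zero.1 hc] at hdep
      exact hdep (by simp)
    · obtain ⟨x, rfl⟩ := Finset.card_eq_one.1 hc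
      exact hdep (by simpa using (hDn x (by simp)))
    · obtain ⟨x, y, hxy, rfl⟩ := Finset.card_eq_two.1 hc
      have hx := hDn x (by simp)
      have hy := hDn y (by simp)
      refine hxy (hRinj x (hJ (hD (by simp))) y (hJ (hD (by simp)))
        ((hx.closure_eq_closure_iff_eq_or_dep hy).2 (Or.inr ?_)))
      simpa using hdep
  refine ⟨fun i => {e | M.IsNonloop e ∧ ρ e ∈ K i}, fun e he => ?_, fun i S hS hinj => ?_⟩
  · obtain ⟨i, hi⟩ := hcov (ρ e) (Finset.mem_image_of_mem _ (Finset.mem_filter.2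
      ⟨hE.mem_toFinset.2 he.mem_ground, he⟩))
    exact ⟨i, he, hi⟩
  · exact indep_of_parallel (hK i) (fun e he => (hS he).1.mem_ground) hinj ρ
      fun e he => ⟨(hS he).2, (hρ e (hS he).1).2⟩

/-! ### The single-item prophet inequality -/

section SingleItem

variable {ι : Type*}

open Classical in
/-- A lower bound, valid for all arrival orders, for the value obtained from the items `C` by a
gambler who accepts the first one of them whose value is at least `t`. -/
def thresholdGain (C : Finset ι) (t : ℝ≥0) (x : ι → ℝ≥0) : ℝ≥0∞ :=
  (if ∃ e ∈ C, t ≤ x e then (t : ℝ≥0∞) else 0) +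
    ∑ e ∈ C, ((x e - t : ℝ≥0) : ℝ≥0∞) * if ∀ f ∈ C.erase e, x f < t then 1 else 0

theorem measurableSet_forall_lt (C : Finset ι) (t : ℝ≥0) :
    MeasurableSet {x : ι → ℝ≥0 | ∀ e ∈ C, x e < t} := by
  have : {x : ι → ℝ≥0 | ∀ e ∈ C, x e < t} = ⋂ e ∈ C, {x | x e < t} := by ext; simp
  rw [this]
  exact Finset.measurableSet_biInter _ fun e _ => measurableSet_lt (by fun_prop) (by fun_prop)

theorem measurableSet_exists_le (C : Finset ι) (t : ℝ≥0) :
    MeasurableSet {x : ι → ℝ≥0 | ∃ e ∈ C, t ≤ x e} := by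
  have : {x : ι → ℝ≥0 | ∃ e ∈ C, t ≤ x e} = {x | ∀ e ∈ C, x e < t}ᶜ := by ext; simp
  rw [this]
  exact (measurableSet_forall_lt C t).compl

theorem measurable_sub_mul_ite [DecidableEq ι] (C : Finset ι) (t : ℝ≥0) (e : ι)
    [∀ x : ι → ℝ≥0, Decidable (∀ f ∈ C.erase e, x f < t)] :
    Measurable fun x : ι → ℝ≥0 => ((x e - t : ℝ≥0) : ℝ≥0∞) *
      if ∀ f ∈ C.erase e, x f < t then 1 else 0 := by
  refine Measurable.mul (by fun_prop) (Measurable.ite ?_ measurable_const measurable_const)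
  exact measurableSet_forall_lt _ _

theorem measurable_thresholdGain (C : Finset ι) (t : ℝ≥0) : Measurable (thresholdGain C t) := by
  classical
  unfold thresholdGain
  refine Measurable.add (Measurable.ite (measurableSet_exists_le C t) measurable_const
    measurable_const) (Finset.measurable_sum _ fun e _ => ?_)
  convert measurable_sub_mul_ite C t e

theorem measurable_sup_coe (C : Finset ι) :
    Measurable fun x : ι → ℝ≥0 => C.sup fun e => (x e : ℝ≥0∞) := by
  have : (fun x : ι → ℝ≥0 => C.sup fun e => (x e : ℝ≥0∞)) =
      fun x => ⨆ e ∈ C, (x e : ℝ≥0∞) := by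
    ext x
    rw [Finset.sup_eq_iSup]
  rw [this]
  exact Measurable.biSup _ C.countable_toSet fun e _ => by fun_prop

/-- If some value reaches `t`, pick `a ∈ A`. Only the summand of `a` can be nonzero, since `a`
itself spoils the condition for all others, and `t + (x a - t) = x a`. If none does, every surplus
is zero. -/
theorem thresholdGain_le {C A : Finset ι} {t : ℝ≥0} {x : ι → ℝ≥0} (hAC : A ⊆ C)
    (hA : ∀ e ∈ A, t ≤ x e) (hne : ∀ e ∈ C, t ≤ x e → A.Nonempty) :
    thresholdGain C t x ≤ ∑ e ∈ A, (x e : ℝ≥0∞) := by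
  classical
  unfold thresholdGain
  by_cases h : ∃ e ∈ C, t ≤ x e
  · obtain ⟨e, he, het⟩ := h
    obtain ⟨a, ha⟩ := hne e he het
    rw [if_pos ⟨e, he, het⟩, Finset.sum_eq_single a]
    · calc (t : ℝ≥0∞) + ((x a - t : ℝ≥0) : ℝ≥0∞) * (if ∀ f ∈ C.erase a, x f < t then 1 else 0)
          ≤ t + ((x a - t : ℝ≥0) : ℝ≥0∞) * 1 := by gcongr; split_ifs <;> simp
        _ = x a := by rw [mul_one, ← ENNReal.coe_add, add_tsub_cancel_of_le (hA a ha)]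
        _ ≤ _ := Finset.single_le_sum (f := fun e => (x e : ℝ≥0∞)) (fun _ _ => zero_le) ha
    · intro f _ hfa
      rw [if_neg, mul_zero]
      exact fun hf => (hA a ha).not_gt (hf a (Finset.mem_erase.2 ⟨hfa.symm, hAC ha⟩))
    · exact fun h => absurd (hAC ha) h
  · rw [if_neg h, zero_add]
    push Not at h
    refine le_of_eq_of_le (Finset.sum_eq_zero fun e he => ?_) zero_le
    rw [tsub_eq_zero_of_le (h e he).le]
    simp

theorem sup_le_add_sum (C : Finset ι) (t : ℝ≥0) (x : ι → ℝ≥0) :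
    (C.sup fun e => (x e : ℝ≥0∞)) ≤ t + ∑ e ∈ C, ((x e - t : ℝ≥0) : ℝ≥0∞) := by
  refine Finset.sup_le fun e he => ?_
  calc (x e : ℝ≥0∞) ≤ t + ((x e - t : ℝ≥0) : ℝ≥0∞) := by
        rw [← ENNReal.coe_add]
        exact ENNReal.coe_le_coe.2 le_add_tsub
    _ ≤ _ := by
        gcongr
        exact Finset.single_le_sum (f := fun e => ((x e - t : ℝ≥0) : ℝ≥0∞)) (fun _ _ => zero_le) he

variable [Fintype ι] (D : ι → Measure ℝ≥0) [∀ e, IsProbabilityMeasure (D e)]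

theorem lintegral_sub_mul_ite [DecidableEq ι] (C : Finset ι) (t : ℝ≥0) (e : ι)
    [∀ x : ι → ℝ≥0, Decidable (∀ f ∈ C.erase e, x f < t)] :
    ∫⁻ x, ((x e - t : ℝ≥0) : ℝ≥0∞) * (if ∀ f ∈ C.erase e, x f < t then 1 else 0)
        ∂Measure.pi D =
      (∫⁻ x, ((x e - t : ℝ≥0) : ℝ≥0∞) ∂Measure.pi D) *
        Measure.pi D {x | ∀ f ∈ C.erase e, x f < t} := by
  have hind : iIndepFun (fun (i : ι) (x : ι → ℝ≥0) => x i) (Measure.pi D) :=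
    iIndepFun_pi (X := fun _ => id) fun _ => aemeasurable_id
  let s : Set (↥(C.erase e) → ℝ≥0) := {y | ∀ f, y f < t}
  have hs : MeasurableSet s := by
    have : s = ⋂ f, {y | y f < t} := by ext; simp [s]
    rw [this]
    exact MeasurableSet.iInter fun f => measurableSet_lt (by fun_prop) (by fun_prop)
  have hψ : Measurable (s.indicator fun _ => (1 : ℝ≥0∞)) := measurable_const.indicator hs
  have hφ : Measurable fun y : ↥({e} : Finset ι) → ℝ≥0 =>
      ((y ⟨e, by simp⟩ - t : ℝ≥0) : ℝ≥0∞) := by fun_prop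
  have h1 := hind.indepFun_finset {e} (C.erase e) (by simp) fun i => measurable_pi_apply i
  have h2 := h1.comp hφ hψ
  have h3 := lintegral_mul_eq_lintegral_mul_lintegral_of_indepFun''
    (hφ.comp (by fun_prop)).aemeasurable (hψ.comp (by fun_prop)).aemeasurable h2
  have h4 : ∀ x : ι → ℝ≥0, (s.indicator (fun _ => (1 : ℝ≥0∞)) ∘ fun a i => a i) x =
      if ∀ f ∈ C.erase e, x f < t then 1 else 0 := by
    intro x
    rw [Function.comp_apply, Set.indicator_apply]
    exact if_congr (by simp [s]) rfl rfl
  simp only [h4, Function.comp_apply] at h3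
  rw [h3, ← lintegral_indicator_one (measurableSet_forall_lt _ _)]
  congr 1
  refine lintegral_congr fun x => ?_
  rw [Set.indicator_apply]
  rfl

/-- The surplus of `e` is independent of the event that all other values in `C` are below `t`, and
this event contains the event that all values are. -/
theorem le_lintegral_thresholdGain (C : Finset ι) (t : ℝ≥0) :
    t * Measure.pi D {x | ∃ e ∈ C, t ≤ x e} +
        (∫⁻ x, ∑ e ∈ C, ((x e - t : ℝ≥0) : ℝ≥0∞) ∂Measure.pi D) *
          Measure.pi D {x | ∀ e ∈ C, x e < t} ≤
      ∫⁻ x, thresholdGain C t x ∂Measure.pi D := by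
  classical
  unfold thresholdGain
  rw [lintegral_add_left (Measurable.ite (measurableSet_exists_le C t) measurable_const
    measurable_const), lintegral_finsetSum _ fun e _ => by fun_prop,
    lintegral_finsetSum _ fun e _ => by convert measurable_sub_mul_ite C t e, Finset.sum_mul]
  refine add_le_add (le_of_eq ?_) (Finset.sum_le_sum fun e _ => ?_)
  · rw [← lintegral_indicator_const (measurableSet_exists_le C t)]
    refine lintegral_congr fun x => ?_
    rw [Set.indicator_apply]
    rfl
  · convert (le_trans ?_ (lintegral_sub_mul_ite D C t e).ge)
    exact mul_le_mul' le_rfl (measure_mono fun x hx f hf => hx f (Finset.mem_of_mem_erase hf))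

/-- The prophet inequality for a single item, with one threshold for all the values and an
arbitrary arrival order. -/
theorem exists_threshold (C : Finset ι) :
    ∃ t : ℝ≥0, (∫⁻ x, (C.sup fun e => (x e : ℝ≥0∞)) ∂Measure.pi D) / 2 ≤
      ∫⁻ x, thresholdGain C t x ∂Measure.pi D := by
  set m := ∫⁻ x, (C.sup fun e => (x e : ℝ≥0∞)) ∂Measure.pi D with hm
  have hmle : ∀ t : ℝ≥0, m ≤ t + ∫⁻ x, ∑ e ∈ C, ((x e - t : ℝ≥0) : ℝ≥0∞) ∂Measure.pi D := by
    intro t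
    refine (lintegral_mono fun x => sup_le_add_sum C t x).trans (le_of_eq ?_)
    rw [lintegral_add_left measurable_const, lintegral_const, measure_univ, mul_one]
  -- When `m` is infinite, so is the expected surplus over any finite `t`; it suffices that all
  -- values lie below `t` with positive probability.
  by_cases hfin : m = ∞
  · have hpos : ∃ n : ℕ, Measure.pi D {x | ∀ e ∈ C, x e < (n : ℝ≥0)} ≠ 0 := by
      by_contra! hz
      have h1 := measure_iUnion_null hz
      have h2 : (⋃ n : ℕ, {x : ι → ℝ≥0 | ∀ e ∈ C, x e < (n : ℝ≥0)}) = Set.univ := by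
        rw [Set.eq_univ_iff_forall]
        intro x
        obtain ⟨n, hn⟩ := exists_nat_gt (C.sup x)
        exact Set.mem_iUnion.2 ⟨n, fun e he => (Finset.le_sup he).trans_lt hn⟩
      rw [h2, measure_univ] at h1
      exact one_ne_zero h1
    obtain ⟨n, hn⟩ := hpos
    refine ⟨n, le_trans ?_ (le_lintegral_thresholdGain D C n)⟩
    have h1 := hmle n
    rw [hfin, top_le_iff, ENNReal.add_eq_top] at h1
    rw [h1.resolve_left ENNReal.coe_ne_top, ENNReal.top_mul hn]
    simp
  · have ht : (((m / 2).toNNReal : ℝ≥0) : ℝ≥0∞) = m / 2 :=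
      ENNReal.coe_toNNReal (ENNReal.div_ne_top hfin two_ne_zero)
    -- With `t = m / 2` the expected total surplus is at least `m - t = t`, so both terms of the
    -- bound carry the factor `t` and their probabilities add up to one.
    refine ⟨(m / 2).toNNReal, le_trans ?_ (le_lintegral_thresholdGain D C _)⟩
    set t := (m / 2).toNNReal
    have h1 := hmle t
    have h2 : (t : ℝ≥0∞) ≤ ∫⁻ x, ∑ e ∈ C, ((x e - t : ℝ≥0) : ℝ≥0∞) ∂Measure.pi D := by
      rw [← ENNReal.add_halves m, ← ht] at h1
      exact (ENNReal.add_le_add_iff_left ENNReal.coe_ne_top).1 h1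
    have h3 : Measure.pi D {x | ∃ e ∈ C, t ≤ x e} + Measure.pi D {x | ∀ e ∈ C, x e < t} = 1 := by
      have h4 : {x : ι → ℝ≥0 | ∃ e ∈ C, t ≤ x e} = {x | ∀ e ∈ C, x e < t}ᶜ := by ext; simp
      rw [h4, add_comm, measure_add_measure_compl (measurableSet_forall_lt C t), measure_univ]
    calc m / 2 = t * (Measure.pi D {x | ∃ e ∈ C, t ≤ x e} +
          Measure.pi D {x | ∀ e ∈ C, x e < t}) := by rw [h3, ht, mul_one]
      _ = t * Measure.pi D {x | ∃ e ∈ C, t ≤ x e} +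
          t * Measure.pi D {x | ∀ e ∈ C, x e < t} := mul_add _ _ _
      _ ≤ _ := by gcongr

end SingleItem

/-! ### The gambler on a partition matroid -/

section Accepted

variable {β κ : Type*} {M : Matroid β} {T : M.E → WithTop ℝ} {x : M.E → ℝ≥0}

theorem subset_accepted (S : Finset M.E) (l : List M.E) : S ⊆ accepted M T x S l := by
  classical
  induction l generalizing S with
  | nil => exact subset_rfl
  | cons e l ih =>
    rw [accepted]
    split_ifs
    · refine subset_trans ?_ (ih _)
      convert Finset.subset_insert e S
    · exact ih _

theorem threshold_le_of_mem_accepted {S : Finset M.E} {l : List M.E} {e : M.E}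
    (he : e ∈ accepted M T x S l) : e ∈ S ∨ T e ≤ ((x e : ℝ) : WithTop ℝ) := by
  classical
  induction l generalizing S with
  | nil => exact Or.inl he
  | cons f l ih =>
    rw [accepted] at he
    split_ifs at he with h
    · rcases ih he with h1 | h1
      · rcases Finset.mem_insert.1 h1 with rfl | h2
        · exact Or.inr h.1
        · exact Or.inl h2
      · exact Or.inr h1
    · exact ih he

/-- The infinite thresholds keep the accepted set inside `U`, where one item per class suffices for
feasibility. So an item that reaches its threshold is rejected only if its class is already
represented. -/
theorem exists_mem_accepted {c : M.E → κ} {U : Finset M.E}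
    (h1 : ∀ S, Feasible M S → Set.InjOn c S)
    (h2 : ∀ S ⊆ U, Set.InjOn c (S : Set M.E) → Feasible M S) (hT : ∀ e ∉ U, T e = ⊤)
    {S : Finset M.E} (hSU : S ⊆ U) (hS : Set.InjOn c (S : Set M.E)) {l : List M.E} {e : M.E}
    (hel : e ∈ l) (he : T e ≤ ((x e : ℝ) : WithTop ℝ)) :
    ∃ f ∈ accepted M T x S l, c f = c e := by
  classical
  have hU : ∀ f, T f ≤ ((x f : ℝ) : WithTop ℝ) → f ∈ U := by
    intro f hf
    by_contra hfU
    rw [hT f hfU, top_le_iff] at hf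
    exact WithTop.coe_ne_top hf
  induction l generalizing S with
  | nil => simp at hel
  | cons f l ih =>
    rw [accepted]
    split_ifs with h
    · rcases List.mem_cons.1 hel with rfl | hel
      · refine ⟨e, subset_accepted _ _ ?_, rfl⟩
        simp
      · refine ih ?_ ?_ hel
        · exact Finset.insert_subset (hU f h.1) hSU
        · exact h1 _ h.2
    · rcases List.mem_cons.1 hel with rfl | hel
      · by_contra! hne
        refine h ⟨he, h2 _ (Finset.insert_subset (hU e he) hSU) ?_⟩
        have hS' : ∀ f ∈ S, c f ≠ c e := fun f hf => hne f (subset_accepted _ _ hf)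
        intro a ha b hb hab
        simp only [Finset.coe_insert, Set.mem_insert_iff, Finset.mem_coe] at ha hb
        rcases ha with rfl | ha <;> rcases hb with rfl | hb
        · rfl
        · exact absurd hab.symm (hS' b hb)
        · exact absurd hab (hS' a ha)
        · exact hS ha hb hab
      · exact ih hSU hS hel

open Classical in
theorem sum_thresholdGain_le_gamblerValue {c : M.E → κ} {U : Finset M.E}
    (h1 : ∀ S, Feasible M S → Set.InjOn c S)
    (h2 : ∀ S ⊆ U, Set.InjOn c (S : Set M.E) → Feasible M S) (t : κ → ℝ≥0)
    (hT : ∀ e, T e = if e ∈ U then (((t (c e) : ℝ≥0) : ℝ) : WithTop ℝ) else ⊤)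
    (N : Finset κ) {l : List M.E} (hl : ∀ e, e ∈ l) :
    ∑ k ∈ N, thresholdGain (U.filter fun e => c e = k) (t k) x ≤ gamblerValue M T x l := by
  have hacc : ∀ e ∈ accepted M T x ∅ l, e ∈ U ∧ t (c e) ≤ x e := by
    intro e he
    have h := (threshold_le_of_mem_accepted he).resolve_left (by simp)
    rw [hT] at h
    split_ifs at h with heU
    · exact ⟨heU, by exact_mod_cast h⟩
    · exact absurd (top_le_iff.1 h) WithTop.coe_ne_top
  calc ∑ k ∈ N, thresholdGain (U.filter fun e => c e = k) (t k) x
      ≤ ∑ k ∈ N, ∑ e ∈ (accepted M T x ∅ l).filter (fun e => c e = k), (x e : ℝ≥0∞) := by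
        refine Finset.sum_le_sum fun k _ => thresholdGain_le ?_ ?_ ?_
        · intro e he
          rw [Finset.mem_filter] at he ⊢
          exact ⟨(hacc e he.1).1, he.2⟩
        · intro e he
          rw [Finset.mem_filter] at he
          exact he.2 ▸ (hacc e he.1).2
        · intro e he het
          rw [Finset.mem_filter] at he
          obtain ⟨f, hf, hfe⟩ := exists_mem_accepted (T := T) (x := x) h1 h2
            (fun e he => by rw [hT, if_neg he]) (Finset.empty_subset _) (by simp) (hl e)
            (by rw [hT, if_pos he.1, he.2]; exact_mod_cast het)
          exact ⟨f, Finset.mem_filter.2 ⟨hf, hfe.trans he.2⟩⟩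
    _ = ∑ e ∈ (accepted M T x ∅ l).filter (fun e => c e ∈ N), (x e : ℝ≥0∞) := by
        rw [← Finset.sum_fiberwise_of_maps_to (s := (accepted M T x ∅ l).filter (fun e => c e ∈ N))
          (t := N) (g := c) fun e he => (Finset.mem_filter.1 he).2]
        refine Finset.sum_congr rfl fun k hk => Finset.sum_congr ?_ fun _ _ => rfl
        ext e
        simp only [Finset.mem_filter]
        constructor
        · rintro ⟨h, rfl⟩
          exact ⟨⟨h, hk⟩, rfl⟩
        · rintro ⟨⟨h, -⟩, h'⟩
          exact ⟨h, h'⟩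
    _ ≤ gamblerValue M T x l :=
        Finset.sum_le_sum_of_subset (Finset.filter_subset _ _)

end Accepted

/-! ### The mechanism and its competitive ratio -/

section Mechanism

variable {β : Type v} {κ : Type*} {M : Matroid β}

open Classical in
-- A feasible set has at most one item per class, so assigning each item to a pair of a covering set
-- and its class is injective, and its value is at most the maximum over that pair.
theorem prophetValue_le_sum {k : ℕ} {c : M.E → κ} {U : Fin k → Finset M.E}
    (h1 : ∀ S, Feasible M S → Set.InjOn c S)
    (hU : ∀ S, Feasible M S → ∀ e ∈ S, ∃ i, e ∈ U i) {N : Finset κ} (hN : ∀ e, c e ∈ N)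
    (x : M.E → ℝ≥0) :
    prophetValue M x ≤
      ∑ i, ∑ a ∈ N, ((U i).filter fun e => c e = a).sup fun e => (x e : ℝ≥0∞) := by
  refine iSup₂_le fun S hS => ?_
  rcases S.eq_empty_or_nonempty with rfl | ⟨e₀, he₀⟩
  · simp
  obtain ⟨i₀, -⟩ := hU S hS e₀ he₀
  have : Nonempty (Fin k) := ⟨i₀⟩
  choose! i hi using hU S hS
  have hinj : Set.InjOn (fun e => (i e, c e)) (S : Set M.E) :=
    fun a ha b hb hab => h1 S hS ha hb (Prod.ext_iff.1 hab).2
  let g : Fin k × κ → ℝ≥0∞ := fun p => ((U p.1).filter fun e => c e = p.2).sup fun e => (x e : ℝ≥0∞)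
  calc ∑ e ∈ S, (x e : ℝ≥0∞) ≤ ∑ e ∈ S, g (i e, c e) :=
        Finset.sum_le_sum fun e he => Finset.le_sup (f := fun e => (x e : ℝ≥0∞))
          (Finset.mem_filter.2 ⟨hi e he, rfl⟩)
    _ = ∑ p ∈ S.image fun e => (i e, c e), g p := (Finset.sum_image hinj).symm
    _ ≤ ∑ p ∈ Finset.univ ×ˢ N, g p := by
        refine Finset.sum_le_sum_of_subset fun p hp => ?_
        obtain ⟨e, -, rfl⟩ := Finset.mem_image.1 hp
        simp [hN]
    _ = _ := Finset.sum_product _ _ _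

/-- If the items that are not loops are covered by `k` sets such that each of them carries a
partition matroid, then choosing one of the sets at random and running a single-item mechanism in
each part is `2 k`-competitive. -/
theorem exists_isCompetitive_of_partition [Finite M.E] {k : ℕ} (hk : k ≠ 0) (c : M.E → κ)
    (U : Fin k → Finset M.E) (h1 : ∀ S, Feasible M S → Set.InjOn c S)
    (hU : ∀ S, Feasible M S → ∀ e ∈ S, ∃ i, e ∈ U i)
    (h2 : ∀ i, ∀ S ⊆ U i, Set.InjOn c (S : Set M.E) → Feasible M S) :
    ∃ A : NonAdaptiveMechanism M.E,
      NonAdaptiveMechanism.IsCompetitive.{v, w} A (2 * k) := by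
  classical
  have := Fintype.ofFinite M.E
  let C : Fin k → κ → Finset M.E := fun i a => (U i).filter fun e => c e = a
  let N : Finset κ := Finset.univ.image c
  let t : (M.E → Measure ℝ≥0) → Fin k → κ → ℝ≥0 := fun D i a =>
    -- The default 0 never matters: competitiveness is only tested on laws of random variables.
    if h : ∀ e, IsProbabilityMeasure (D e) then (exists_threshold D (C i a)).choose else 0
  let T : (M.E → Measure ℝ≥0) → Fin k → M.E → WithTop ℝ := fun D i e =>
    if e ∈ U i then (((t D i (c e) : ℝ≥0) : ℝ) : WithTop ℝ) else ⊤
  have hk' : (k : ℝ≥0∞) ≠ 0 := by exact_mod_cast hk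
  refine ⟨⟨fun D => ∑ i, (k : ℝ≥0∞)⁻¹ • Measure.dirac (T D i), fun D _ => ⟨?_⟩⟩, ?_⟩
  · simp [ENNReal.mul_inv_cancel hk' (ENNReal.natCast_ne_top k)]
  intro Ω _ P _ X hX hind
  let D : M.E → Measure ℝ≥0 := fun e => P.map (X e)
  have hD : ∀ e, IsProbabilityMeasure (D e) := fun e =>
    Measure.isProbabilityMeasure_map (hX e).aemeasurable
  have hmeas : Measurable fun ω e => X e ω := measurable_pi_lambda _ hX
  have hmap : P.map (fun ω e => X e ω) = Measure.pi D :=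
    (iIndepFun_iff_map_fun_eq_pi_map fun e => (hX e).aemeasurable).1 hind
  have ht : ∀ i a, (∫⁻ x, ((C i a).sup fun e => (x e : ℝ≥0∞)) ∂Measure.pi D) / 2 ≤
      ∫⁻ x, thresholdGain (C i a) (t D i a) x ∂Measure.pi D := by
    intro i a
    simp only [t, dif_pos hD]
    exact (exists_threshold D (C i a)).choose_spec
  have hprophet : ∫⁻ ω, prophetValue M (fun e => X e ω) ∂P ≤
      ∑ i, ∑ a ∈ N, ∫⁻ x, ((C i a).sup fun e => (x e : ℝ≥0∞)) ∂Measure.pi D := by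
    calc ∫⁻ ω, prophetValue M (fun e => X e ω) ∂P
        ≤ ∫⁻ ω, ∑ i, ∑ a ∈ N, (C i a).sup (fun e => (X e ω : ℝ≥0∞)) ∂P :=
          lintegral_mono fun ω => prophetValue_le_sum h1 hU
            (fun e => Finset.mem_image_of_mem c (Finset.mem_univ e)) _
      _ = ∫⁻ x, ∑ i, ∑ a ∈ N, (C i a).sup (fun e => (x e : ℝ≥0∞)) ∂Measure.pi D := by
          rw [← hmap, lintegral_map (Finset.measurable_sum _ fun i _ =>
            Finset.measurable_sum _ fun a _ => measurable_sup_coe _) hmeas]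
      _ = _ := by
          rw [lintegral_finsetSum _ fun i _ =>
            Finset.measurable_sum _ fun a _ => measurable_sup_coe _]
          exact Finset.sum_congr rfl fun i _ =>
            lintegral_finsetSum _ fun a _ => measurable_sup_coe _
  have hgain : ∀ i, (∑ a ∈ N, ∫⁻ x, ((C i a).sup fun e => (x e : ℝ≥0∞)) ∂Measure.pi D) / 2 ≤
      worstCaseGain M P X (T D i) := by
    intro i
    -- The lower bound by threshold gains holds pointwise and does not depend on the order, so the
    -- infimum costs nothing.
    refine le_iInf fun l => ?_
    calc (∑ a ∈ N, ∫⁻ x, ((C i a).sup fun e => (x e : ℝ≥0∞)) ∂Measure.pi D) / 2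
        ≤ ∑ a ∈ N, ∫⁻ x, thresholdGain (C i a) (t D i a) x ∂Measure.pi D := by
          rw [div_eq_mul_inv, Finset.sum_mul]
          exact Finset.sum_le_sum fun a _ => by simpa only [div_eq_mul_inv] using ht i a
      _ = ∫⁻ x, ∑ a ∈ N, thresholdGain (C i a) (t D i a) x ∂Measure.pi D :=
          (lintegral_finsetSum _ fun a _ => measurable_thresholdGain _ _).symm
      _ = ∫⁻ ω, ∑ a ∈ N, thresholdGain (C i a) (t D i a) (fun e => X e ω) ∂P := by
          rw [← hmap, lintegral_map (Finset.measurable_sum _ fun a _ =>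
            measurable_thresholdGain _ _) hmeas]
      _ ≤ _ := lintegral_mono fun ω =>
          sum_thresholdGain_le_gamblerValue h1 (h2 i) (t D i) (fun e => rfl) N l.2.2
  change _ ≤ ∫⁻ T', worstCaseGain M P X T' ∂(∑ i, (k : ℝ≥0∞)⁻¹ • Measure.dirac (T D i))
  rw [lintegral_finsetSum_measure]
  simp only [lintegral_smul_measure, lintegral_dirac, smul_eq_mul]
  calc (∫⁻ ω, prophetValue M (fun e => X e ω) ∂P) / ((2 * k : ℝ≥0) : ℝ≥0∞)
      ≤ (∑ i, ∑ a ∈ N, ∫⁻ x, ((C i a).sup fun e => (x e : ℝ≥0∞)) ∂Measure.pi D) /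
          ((2 * k : ℝ≥0) : ℝ≥0∞) := by gcongr
    _ = ∑ i, (k : ℝ≥0∞)⁻¹ *
          ((∑ a ∈ N, ∫⁻ x, ((C i a).sup fun e => (x e : ℝ≥0∞)) ∂Measure.pi D) / 2) := by
        rw [div_eq_mul_inv, Finset.sum_mul]
        refine Finset.sum_congr rfl fun i _ => ?_
        have : ((2 * k : ℝ≥0) : ℝ≥0∞)⁻¹ = 2⁻¹ * (k : ℝ≥0∞)⁻¹ := by
          push_cast
          exact ENNReal.mul_inv (by simp) (by simp)
        rw [this, div_eq_mul_inv]
        ring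
    _ ≤ _ := by
        gcongr with i
        exact hgain i

end Mechanism

end MatroidProphet
end
theorem mainTheorem4 {α : Type u} {β : Type v} (G : Graph α β)
    (_hV : G.vertexSet.Finite) (hE : G.edgeSet.Finite) :
    ∃ A : MatroidProphet.NonAdaptiveMechanism (MatroidProphet.cographicMatroid G hE).E,
      MatroidProphet.NonAdaptiveMechanism.IsCompetitive.{v, w} A 6 := by
  classical
  set M := MatroidProphet.cographicMatroid G hE
  have : Finite M.E := hE
  have := Fintype.ofFinite M.E
  obtain ⟨U, hU, hind⟩ := MatroidProphet.exists_parallel_cover_cographicMatroid G hE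
  -- Items are classified by the closure of their singleton, that is, by parallel class; three
  -- covering sets give the ratio `2 * 3 = 6`.
  have h := MatroidProphet.exists_isCompetitive_of_partition.{v, w} (M := M) (k := 3) (by norm_num)
    (fun e => M.closure {(e : β)}) (fun i => Finset.univ.filter fun e => (e : β) ∈ U i)
    (fun S hS a ha b hb hab => Subtype.ext (MatroidProphet.injOn_closure_singleton hS
      ⟨a, ha, rfl⟩ ⟨b, hb, rfl⟩ hab))
    (fun S hS e he => by
      obtain ⟨i, hi⟩ := hU e (Matroid.Indep.isNonloop_of_mem hS ⟨e, he, rfl⟩)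
      exact ⟨i, by simpa using hi⟩)
    (fun i S hS hinj => by
      refine hind i _ ?_ ?_
      · rintro _ ⟨e, he, rfl⟩
        exact (Finset.mem_filter.1 (hS he)).2
      · rintro _ ⟨a, ha, rfl⟩ _ ⟨b, hb, rfl⟩ hab
        exact congrArg Subtype.val (hinj ha hb hab))
  convert h using 2
  norm_num
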